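/- Let $X$ be a nonempty finite set and let $(X,\{R_i\}_{i\in I})$ be a commutative association scheme (the $R_i$ are nonempty and partition $X^2$, one of them is the diagonal, the inverse of each $R_i$ is some $R_j$, and the numbers $|\{z : (x,z)\in R_i,\ (z,y)\in R_j\}|$, $(x,y)\in R_k$, depend only on $i,j,k$ and are symmetric in $i,j$), with adjacency matrices $A_i$. Let $\le$ be a monomial order on $\mathbb N^\ell$ and $\mathcal D^*\subset\mathbb N^\ell$ a finite set that contains the unit vectors $\epsilon_1,\dots,\epsilon_\ell$ and, with each $n$, every $m$ with $m_i\le n_i$ for all $i$. Assume that the scheme is $\ell$-variate $Q$-polynomial on $\mathcal D^*$ with respect to $\le$: the primitive idempotents of $\operatorname{span}\{A_i\}$ are labelled $E_\alpha$, $\alpha\in\mathcal D^*$, so that, with $\circ$ the entrywise product, * for each $\alpha\in\mathcal D^*$, $|X|E_\alpha=v_\alpha(|X|E_{\epsilon_1},\dots,|X|E_{\epsilon_\ell})$ under $\circ$, for a polynomial $v_\alpha$ of multidegree $\alpha$ (the coefficient of $x^\alpha$ is nonzero and all monomials $x^\beta$ that occur have $\beta\le\alpha$) all of whose monomials $x^\beta$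 have $\beta\in\mathcal D^*$; * for $\alpha\in\mathcal D^*$ and $1\le i\le\ell$, the matrix $E_{\epsilon_i}\circ E_{\epsilon_1}^{\circ\alpha_1}\circ\cdots\circ E_{\epsilon_\ell}^{\circ\alpha_\ell}$ is a linear combination of the matrices $E_{\epsilon_1}^{\circ\beta_1}\circ\cdots\circ E_{\epsilon_\ell}^{\circ\beta_\ell}$ with $\beta\in\mathcal D^*$, $\beta\le\alpha+\epsilon_i$. Let $\mu_\alpha=\operatorname{rank}E_\alpha$, let the second eigenvalues $Q_\alpha(i)$ and the Krein parameters $q_{\alpha\beta}^\gamma$ be given by $|X|E_\alpha=\sum_i Q_\alpha(i)A_i$ and $|X|\,E_\alpha\circ E_\beta=\sum_\gamma q_{\alpha\beta}^\gamma E_\gamma$. Call $d:\mathcal D^*\to\mathbb R_{\ge0}$ a *distance function on $\mathcal D^*$* (and the scheme weakly metric for $d$) if $d(\alpha)=0$ exactly for $\alpha=0$, $d(\alpha)=d(\beta)$ whenever $E_\alpha^{\top}=E_\beta$, and $d(\gamma)\le d(\alpha)+d(\beta)$ whenever $q_{\alpha\beta}^\gamma\ne0$. 1. (Distance Rao bound.)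 Let $d$ be a distance function on $\mathcal D^*$, $t\ge1$ an integer, $e=\lfloor t/2\rfloor$, and let $Y\subseteq X$ be a nonempty $t$-design, that is, its inner distribution $a_i=|R_i\cap Y^2|/|Y|$ satisfies $\sum_i a_iQ_\alpha(i)=0$ for all $\alpha\in\mathcal D^*$ with $0<d(\alpha)\le t$. Then $$|Y|\ \ge\ \sum_{\alpha\in\mathcal D^*,\ d(\alpha)\le e}\mu_\alpha .$$ 2. A weighted degree $d(\alpha)=w_1\alpha_1+\cdots+w_\ell\alpha_\ell$, $w_i>0$, is a distance function on $\mathcal D^*$ whenever $\alpha\le\beta$ implies $d(\alpha)\le d(\beta)$ on $\mathbb N^\ell$, and $d(\alpha)=d(\beta)$ whenever $E_\alpha^\top=E_\beta$ with $\alpha,\beta\in\mathcal D^*$ (the latter is automatic if all $R_i$ are symmetric). 3. Suppose that the relations can be relabelled $R_\alpha$, $\alpha\in\mathcal D^*$, so that the scheme is self-dual: $P_\alpha(\beta)=Q_\alpha(\beta)$ for all $\alpha,\beta$, where $A_\alpha=\sum_\beta P_\alpha(\beta)E_\beta$. If a metric on $X$ is constant on each relation $R_\alpha$, with value $d(\alpha)$,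 then $d$ is a distance function on $\mathcal D^*$. In particular the bound of 1 holds for the distances in 2 and 3. -/

import Mathlib

open scoped Matrix MonomialOrder

/-- A commutative association scheme on the finite set `X` with classes `R i`, `i : I`.
The partition of `X × X` is given by the function `rel` sending a pair to the index of its class;
every class is nonempty. -/
structure AssocScheme (X I : Type*) [Fintype X] where
  rel : X → X → I
  /-- The index of the diagonal class. -/
  diag : I
  rel_surjective : ∀ i, ∃ x y, rel x y = i
  rel_eq_diag_iff : ∀ x y, rel x y = diag ↔ x = y
  inverse : ∀ i, ∃ j, ∀ x y, rel x y = i ↔ rel y x = j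
  intersection : ∀ i j k, ∃ p : ℕ, ∀ x y, rel x y = k →
    Nat.card {z // rel x z = i ∧ rel z y = j} = p ∧
    Nat.card {z // rel x z = j ∧ rel z y = i} = p

namespace AssocScheme

variable {X I J : Type*} [Fintype X]

open Classical in
/-- The adjacency matrix `A_i`. -/
noncomputable def adj (S : AssocScheme X I) (i : I) : Matrix X X ℂ :=
  Matrix.of fun x y => if S.rel x y = i then 1 else 0

/-- The underlying space of the Bose-Mesner algebra. -/
noncomputable def boseMesner (S : AssocScheme X I) : Submodule ℂ (Matrix X X ℂ) :=
  Submodule.span ℂ (Set.range S.adj)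

open Classical in
/-- `E` is the family of the primitive idempotents of the Bose-Mesner algebra, indexed by `J`. -/
structure IsPrimitiveIdempotents [Fintype J] (S : AssocScheme X I) (E : J → Matrix X X ℂ) :
    Prop where
  linearIndependent : LinearIndependent ℂ E
  span_eq : Submodule.span ℂ (Set.range E) = S.boseMesner
  idem : ∀ j, E j * E j = E j
  orthogonal : ∀ j k, j ≠ k → E j * E k = 0
  sum_eq_one : ∑ j, E j = 1

/-- `P j i = P_i(j)` is the array of first eigenvalues: `A_i = ∑ j, P_i(j) E_j`. -/
def IsFirstEigenmatrix [Fintype J] (S : AssocScheme X I) (E : J → Matrix X X ℂ)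
    (P : Matrix J I ℂ) : Prop :=
  ∀ i, S.adj i = ∑ j, P j i • E j

/-- `Q i j = Q_j(i)` is the array of second eigenvalues: `|X| E_j = ∑ i, Q_j(i) A_i`. -/
def IsSecondEigenmatrix [Fintype I] (S : AssocScheme X I) (E : J → Matrix X X ℂ)
    (Q : Matrix I J ℂ) : Prop :=
  ∀ j, (Fintype.card X : ℂ) • E j = ∑ i, Q i j • S.adj i

/-- The inner distribution `a_i = |R_i ∩ Y²| / |Y|` of `Y`. -/
noncomputable def innerDistribution (S : AssocScheme X I) (Y : Finset X) (i : I) : ℝ :=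
  (Nat.card {p : X × X // p.1 ∈ Y ∧ p.2 ∈ Y ∧ S.rel p.1 p.2 = i} : ℝ) / Y.card

/-- The scheme is weakly metric for the distance `δ` on `X`, with value `c i` on the class `R_i`. -/
structure IsWeaklyMetric (S : AssocScheme X I) (δ : X → X → ℝ) (c : I → ℝ) : Prop where
  nonneg : ∀ x y, 0 ≤ δ x y
  eq_zero_iff : ∀ x y, δ x y = 0 ↔ x = y
  symm : ∀ x y, δ x y = δ y x
  triangle : ∀ x y z, δ x y ≤ δ x z + δ z y
  eq_on_class : ∀ x y, δ x y = c (S.rel x y)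

end AssocScheme

/-- `q i j k` are the Krein parameters `q_{ij}^k` of the idempotents `E`:
`|X| (E_i ∘ E_j) = ∑ k, q_{ij}^k E_k`, with `∘` the entrywise product. -/
def IsKreinParameters {X J : Type*} [Fintype X] [Fintype J] (E : J → Matrix X X ℂ)
    (q : J → J → J → ℂ) : Prop :=
  ∀ i j, (Fintype.card X : ℂ) • (E i ⊙ E j) = ∑ k, q i j k • E k

/-- The Hadamard monomial `F_1^{∘ β_1} ∘ ⋯ ∘ F_ℓ^{∘ β_ℓ}`. -/
noncomputable def hadamardMonomial {X : Type*} {ℓ : ℕ} (F : Fin ℓ → Matrix X X ℂ)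
    (β : Fin ℓ →₀ ℕ) : Matrix X X ℂ :=
  Matrix.of fun x y => ∏ j, F j x y ^ β j

/-- The scheme `S` is `ℓ`-variate Q-polynomial on the domain `D ⊆ ℕ^ℓ` with respect to the monomial
order `m`, the primitive idempotents being labelled `E α`, `α ∈ D`.
Polynomials are evaluated at matrices entrywise, that is, under the Hadamard product. -/
structure AssocScheme.IsQPolynomial {X I : Type*} [Fintype X] {ℓ : ℕ} (S : AssocScheme X I)
    (m : MonomialOrder (Fin ℓ)) (D : Finset (Fin ℓ →₀ ℕ)) (E : D → Matrix X X ℂ) : Prop where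
  eps_mem : ∀ i, Finsupp.single i 1 ∈ D
  lower : ∀ n ∈ D, ∀ k, (∀ i, k i ≤ n i) → k ∈ D
  idempotents : S.IsPrimitiveIdempotents E
  polynomial : ∀ α : D, ∃ v : MvPolynomial (Fin ℓ) ℂ,
    v.coeff α ≠ 0 ∧ (∀ β ∈ v.support, β ≼[m] (α : Fin ℓ →₀ ℕ) ∧ β ∈ D) ∧
    ∀ x y, (Fintype.card X : ℂ) * E α x y =
      MvPolynomial.eval (fun i => (Fintype.card X : ℂ) * E ⟨Finsupp.single i 1, eps_mem i⟩ x y) v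
  recurrence : ∀ i, ∀ α ∈ D,
    E ⟨Finsupp.single i 1, eps_mem i⟩ ⊙
        hadamardMonomial (fun j => E ⟨Finsupp.single j 1, eps_mem j⟩) α ∈
      Submodule.span ℂ
        {M | ∃ β ∈ D, β ≼[m] α + Finsupp.single i 1 ∧
          M = hadamardMonomial (fun j => E ⟨Finsupp.single j 1, eps_mem j⟩) β}

/-- The scheme is weakly metric on the index set `D` of its idempotents, with distance function `d`:
the counterpart, with the Krein parameters in place of the intersection numbers, of a distance
on `X` that is constant on the classes. (For such a distance, with value `c i` on `R_i`, the
triangle inequality says that `c k ≤ c i + c j` whenever `p_{ij}^k ≠ 0`.) -/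
structure IsDualDistance {X : Type*} [Fintype X] {ℓ : ℕ} {D : Finset (Fin ℓ →₀ ℕ)}
    (E : D → Matrix X X ℂ) (q : D → D → D → ℂ) (d : D → ℝ) : Prop where
  nonneg : ∀ i, 0 ≤ d i
  eq_zero_iff : ∀ i : D, d i = 0 ↔ (i : Fin ℓ →₀ ℕ) = 0
  symm : ∀ i j, (E i)ᵀ = E j → d i = d j
  triangle : ∀ i j k, q i j k ≠ 0 → d k ≤ d i + d j

/-- `Y` is a `T`-design: `(aQ)_i = 0` for all `i ∈ T`, with `a` its inner distribution. -/
def AssocScheme.IsSetDesign {X I J : Type*} [Fintype X] [Fintype I] (S : AssocScheme X I)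
    (Q : Matrix I J ℂ) (T : Set J) (Y : Finset X) : Prop :=
  ∀ j ∈ T, ∑ i, (S.innerDistribution Y i : ℂ) * Q i j = 0

/-- `Y` is a `t`-design: a `T`-design for `T = {j | 0 < d j ≤ t}`. -/
def AssocScheme.IsDesign {X I J : Type*} [Fintype X] [Fintype I] (S : AssocScheme X I)
    (Q : Matrix I J ℂ) (d : J → ℝ) (t : ℕ) (Y : Finset X) : Prop :=
  S.IsSetDesign Q {j | 0 < d j ∧ d j ≤ t} Y

/-- The weighted degree `w_1 α_1 + ⋯ + w_ℓ α_ℓ`. -/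
noncomputable def weightedDegree {ℓ : ℕ} (w : Fin ℓ → ℝ) (α : Fin ℓ →₀ ℕ) : ℝ :=
  ∑ i, w i * α i

/-! The bound is a dimension count. Let V be the sum of the eigenspaces with `d α ≤ e`; its
dimension is the sum of the ranks, so it suffices that restriction to Y is injective on V. If f ∈ V
vanishes on Y, then f̄ ∈ V, because transposition permutes the idempotents and preserves d.
Vanishing Krein parameters confine f f̄ to eigenspaces with `d ≤ 2e ≤ t`, and the design condition
makes the indicator of Y orthogonal to all of these except the constants. Hence 0 = ∑_Y |f|² =
(|Y|/|X|) ‖f‖², so f = 0 (`sum_rank_le_card`).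

For weighted degrees, the recurrence lets products of idempotents be reduced without raising the
monomial order, so `q α β γ ≠ 0` forces γ ≼ α + β (`le_add_of_krein_ne_zero`). For self-dual
schemes, the Krein parameters are the intersection numbers (`adj_mul_adj_eq_sum_krein`), and the
triangle inequality on X carries over. -/

namespace Matrix

/-! ### Entrywise products and projections. -/

variable {X : Type*} [Fintype X]

open ComplexOrder in
/-- If `∑ x y, A x y * B x y * C y x` vanishes for Hermitian idempotents `A`, `B`, `C`, then so do
the triple products of their entries, summed over the common index. -/
theorem sum_mul_mul_eq_zero_of_trace_hadamard_mul_eq_zero {A B C : Matrix X X ℂ}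
    (hA : A.IsHermitian) (hB : B.IsHermitian) (hC : C.IsHermitian)
    (hA' : A * A = A) (hB' : B * B = B) (hC' : C * C = C)
    (h : ((A ⊙ B) * C).trace = 0) (w u v : X) :
    ∑ x, C w x * A x u * B x v = 0 := by
  let T : X × X × X → ℂ := fun p => ∑ x, C p.1 x * A x p.2.1 * B x p.2.2
  suffices hT : T = 0 from congrFun hT (w, u, v)
  -- The trace is the squared norm of the tensor `T`: write each of A, B, C as its own square and
  -- split the entries.
  rw [← dotProduct_star_self_eq_zero, ← h]
  have hstar : ∀ p, star (T p) = ∑ y, C y p.1 * A p.2.1 y * B p.2.2 y := fun p => by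
    simp only [T, star_sum, star_mul', hA.apply, hB.apply, hC.apply]
  simp only [dotProduct, Pi.star_apply, hstar]
  simp only [T, Finset.sum_mul_sum]
  rw [Finset.sum_comm, Finset.sum_congr rfl fun y _ => Finset.sum_comm, Finset.sum_comm]
  simp only [trace, diag_apply, mul_apply, hadamard_apply]
  refine Finset.sum_congr rfl fun x _ => Finset.sum_congr rfl fun y _ => ?_
  have e1 : A x y = ∑ u, A x u * A u y := by rw [← mul_apply, hA']
  have e2 : B x y = ∑ v, B x v * B v y := by rw [← mul_apply, hB']
  have e3 : C y x = ∑ w, C y w * C w x := by rw [← mul_apply, hC']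
  rw [e1, e2, e3, Fintype.sum_prod_type, mul_comm, Finset.sum_mul_sum, Finset.sum_mul]
  refine Finset.sum_congr rfl fun w _ => ?_
  rw [Fintype.sum_prod_type, Finset.mul_sum]
  refine Finset.sum_congr rfl fun u _ => ?_
  rw [Finset.mul_sum]
  refine Finset.sum_congr rfl fun v _ => ?_
  ring

theorem mulVec_mul_mulVec_eq_zero_of_trace_hadamard_mul_eq_zero {A B C : Matrix X X ℂ}
    (hA : A.IsHermitian) (hB : B.IsHermitian) (hC : C.IsHermitian)
    (hA' : A * A = A) (hB' : B * B = B) (hC' : C * C = C)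
    (h : ((A ⊙ B) * C).trace = 0) (f g : X → ℂ) :
    C *ᵥ ((A *ᵥ f) * (B *ᵥ g)) = 0 := by
  ext w
  have key := sum_mul_mul_eq_zero_of_trace_hadamard_mul_eq_zero hA hB hC hA' hB' hC' h w
  calc (C *ᵥ ((A *ᵥ f) * (B *ᵥ g))) w
      = ∑ x, ∑ u, ∑ v, C w x * A x u * B x v * (f u * g v) := by
        simp only [mulVec, dotProduct, Pi.mul_apply, Finset.sum_mul_sum]
        simp only [Finset.mul_sum]
        refine Finset.sum_congr rfl fun x _ => Finset.sum_congr rfl fun u _ =>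
          Finset.sum_congr rfl fun v _ => ?_
        ring
    _ = ∑ u, ∑ v, ∑ x, C w x * A x u * B x v * (f u * g v) := by
        rw [Finset.sum_comm]
        exact Finset.sum_congr rfl fun u _ => Finset.sum_comm
    _ = 0 := by simp only [← Finset.sum_mul, key, zero_mul, Finset.sum_const_zero]

open Classical in
theorem trace_eq_rank_of_mul_self_eq {A : Matrix X X ℂ} (hA : A * A = A) :
    A.trace = A.rank := by
  have h : IsIdempotentElem (Matrix.toLin' A) := by
    rw [IsIdempotentElem, Module.End.mul_eq_comp, ← Matrix.toLin'_mul, hA]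
  rw [← Matrix.trace_toLin'_eq, (LinearMap.IsIdempotentElem.isProj_range _ h).trace]
  rfl

end Matrix

/-! ### The Bose-Mesner algebra and its idempotents. -/

namespace AssocScheme

variable {X I J : Type*} [Fintype X] [Fintype J] {S : AssocScheme X I} {E : J → Matrix X X ℂ}

theorem adj_apply_rel (S : AssocScheme X I) (x y : X) : S.adj (S.rel x y) x y = 1 := by
  simp [adj]

theorem nonempty (S : AssocScheme X I) : Nonempty X :=
  let ⟨x, _, _⟩ := S.rel_surjective S.diag
  ⟨x⟩

theorem card_ne_zero (S : AssocScheme X I) : (Fintype.card X : ℂ) ≠ 0 := by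
  have := S.nonempty
  exact_mod_cast Fintype.card_ne_zero

theorem sum_smul_adj_apply [Fintype I] (S : AssocScheme X I) (c : I → ℂ) (x y : X) :
    (∑ i, c i • S.adj i) x y = c (S.rel x y) := by
  classical
  simp [Matrix.sum_apply, adj]

theorem exists_transpose_adj (S : AssocScheme X I) (i : I) : ∃ j, (S.adj i)ᵀ = S.adj j := by
  obtain ⟨j, hj⟩ := S.inverse i
  refine ⟨j, ?_⟩
  ext x y
  simp only [adj, Matrix.transpose_apply, Matrix.of_apply]
  classical exact if_congr (hj y x) rfl rfl

theorem conjTranspose_adj (S : AssocScheme X I) (i : I) : (S.adj i)ᴴ = (S.adj i)ᵀ := by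
  ext x y
  simp [adj, apply_ite]

theorem transpose_mem_boseMesner {M : Matrix X X ℂ} (hM : M ∈ S.boseMesner) :
    Mᵀ ∈ S.boseMesner := by
  refine Submodule.span_induction (p := fun M _ => Mᵀ ∈ S.boseMesner) ?_ ?_ ?_ ?_ hM
  · rintro _ ⟨i, rfl⟩
    obtain ⟨j, hj⟩ := S.exists_transpose_adj i
    exact hj ▸ Submodule.subset_span ⟨j, rfl⟩
  · simp
  · intro M N _ _ hM hN
    simpa using add_mem hM hN
  · intro c M _ hM
    simpa using Submodule.smul_mem _ c hM

theorem conjTranspose_mem_boseMesner {M : Matrix X X ℂ} (hM : M ∈ S.boseMesner) :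
    Mᴴ ∈ S.boseMesner := by
  refine Submodule.span_induction (p := fun M _ => Mᴴ ∈ S.boseMesner) ?_ ?_ ?_ ?_ hM
  · rintro _ ⟨i, rfl⟩
    rw [conjTranspose_adj]
    exact transpose_mem_boseMesner (Submodule.subset_span ⟨i, rfl⟩)
  · simp
  · intro M N _ _ hM hN
    simpa using add_mem hM hN
  · intro c M _ hM
    simpa using Submodule.smul_mem _ (star c) hM

namespace IsPrimitiveIdempotents

theorem ne_zero (h : S.IsPrimitiveIdempotents E) (j : J) : E j ≠ 0 :=
  h.linearIndependent.ne_zero j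

theorem mem_boseMesner (h : S.IsPrimitiveIdempotents E) (j : J) : E j ∈ S.boseMesner :=
  h.span_eq ▸ Submodule.subset_span ⟨j, rfl⟩

theorem exists_eq_sum_smul (h : S.IsPrimitiveIdempotents E) {M : Matrix X X ℂ}
    (hM : M ∈ S.boseMesner) : ∃ c : J → ℂ, M = ∑ j, c j • E j := by
  rw [← h.span_eq, Submodule.mem_span_range_iff_exists_fun] at hM
  exact hM.imp fun _ => Eq.symm

theorem mul_sum_smul (h : S.IsPrimitiveIdempotents E) (k : J) (c : J → ℂ) :
    E k * ∑ j, c j • E j = c k • E k := by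
  classical
  rw [Finset.mul_sum, Finset.sum_eq_single k]
  · rw [Matrix.mul_smul, h.idem]
  · intro j _ hj
    rw [Matrix.mul_smul, h.orthogonal k j hj.symm, smul_zero]
  · simp

theorem sum_smul_mul_sum_smul (h : S.IsPrimitiveIdempotents E) (b c : J → ℂ) :
    (∑ j, b j • E j) * ∑ j, c j • E j = ∑ j, (b j * c j) • E j := by
  rw [Finset.sum_mul]
  refine Finset.sum_congr rfl fun j _ => ?_
  rw [Matrix.smul_mul, h.mul_sum_smul, smul_smul]

/-- A semilinear anti-involution which preserves the Bose-Mesner algebra permutes the primitive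
idempotents. -/
theorem exists_map_eq (h : S.IsPrimitiveIdempotents E) (τ : Matrix X X ℂ → Matrix X X ℂ)
    (σ : ℂ →+* ℂ) (hmem : ∀ j, τ (E j) ∈ S.boseMesner) (hmul : ∀ M N, τ (M * N) = τ N * τ M)
    (hinv : ∀ M, τ (τ M) = M) (hsmul : ∀ (c : ℂ) M, τ (c • M) = σ c • τ M) (i : J) :
    ∃ j, τ (E i) = E j := by
  have hzero : τ 0 = 0 := by simpa using hsmul 0 0
  have hne : ∀ j, τ (E j) ≠ 0 := fun j hj => h.ne_zero j (by rw [← hinv (E j), hj, hzero])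
  obtain ⟨c, hc⟩ := h.exists_eq_sum_smul (hmem i)
  obtain ⟨j, hj⟩ : ∃ j, c j ≠ 0 := by
    by_contra! h0
    exact hne i (by simp [hc, h0])
  obtain ⟨b, hb⟩ := h.exists_eq_sum_smul (hmem j)
  have h1 : E j * τ (E i) = c j • E j := by rw [hc, h.mul_sum_smul]
  have h2 : E i * τ (E j) = b i • E i := by rw [hb, h.mul_sum_smul]
  -- Applying τ to `E j * τ (E i) = c j • E j` turns the left side into `E i * τ (E j)`. So `τ (E
  -- j)` is a multiple of `E i`, and idempotence makes the factor 1.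
  have h3 : σ (c j) • τ (E j) = b i • E i := by
    rw [← h2, ← hsmul, ← h1, hmul, hinv]
  have hσ : σ (c j) ≠ 0 := by simpa using hj
  obtain ⟨r, hr⟩ : ∃ r : ℂ, τ (E j) = r • E i :=
    ⟨(σ (c j))⁻¹ * b i, by rw [mul_smul, ← h3, smul_smul, inv_mul_cancel₀ hσ, one_smul]⟩
  have hr0 : r ≠ 0 := by
    rintro rfl
    exact hne j (by rw [hr, zero_smul])
  have h4 : (r * r) • E i = r • E i := by
    have : τ (E j) * τ (E j) = τ (E j) := by rw [← hmul, h.idem]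
    rwa [hr, Matrix.smul_mul, Matrix.mul_smul, h.idem, smul_smul] at this
  have h5 : r * r = r := smul_left_injective ℂ (h.ne_zero i) h4
  have h6 : r = 1 := mul_left_cancel₀ hr0 (by rw [h5, mul_one])
  refine ⟨j, ?_⟩
  rw [← hinv (E j), hr, h6, one_smul]

theorem exists_transpose_eq (h : S.IsPrimitiveIdempotents E) (i : J) : ∃ j, (E i)ᵀ = E j :=
  h.exists_map_eq Matrix.transpose (RingHom.id ℂ)
    (fun j => transpose_mem_boseMesner (h.mem_boseMesner j)) Matrix.transpose_mul
    Matrix.transpose_transpose (fun c M => Matrix.transpose_smul c M) i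

-- The adjoint of `E i` is some `E j`. If j ≠ i, orthogonality would give `E i * (E i)ᴴ = 0`, hence
-- `E i = 0`.
open ComplexOrder in
theorem isHermitian (h : S.IsPrimitiveIdempotents E) (i : J) : (E i).IsHermitian := by
  obtain ⟨j, hj⟩ := h.exists_map_eq Matrix.conjTranspose (starRingEnd ℂ)
    (fun j => conjTranspose_mem_boseMesner (h.mem_boseMesner j)) Matrix.conjTranspose_mul
    Matrix.conjTranspose_conjTranspose (fun c M => Matrix.conjTranspose_smul c M) i
  by_cases hij : i = j
  · rw [Matrix.IsHermitian, hj, hij]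
  · have := h.orthogonal i j hij
    rw [← hj] at this
    exact absurd (Matrix.self_mul_conjTranspose_eq_zero.1 this) (h.ne_zero i)

theorem star_apply (h : S.IsPrimitiveIdempotents E) (i : J) (x y : X) :
    star (E i x y) = E i y x :=
  (h.isHermitian i).apply y x

theorem mul_self_sum (h : S.IsPrimitiveIdempotents E) (T : Finset J) :
    (∑ j ∈ T, E j) * ∑ j ∈ T, E j = ∑ j ∈ T, E j := by
  classical
  have e : ∑ j ∈ T, E j = ∑ j, (if j ∈ T then (1 : ℂ) else 0) • E j := by
    simp [ite_smul, Finset.sum_ite_mem]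
  rw [e, h.sum_smul_mul_sum_smul]
  simp

/-- For idempotents the rank is the trace, which is additive. -/
theorem rank_sum (h : S.IsPrimitiveIdempotents E) (T : Finset J) :
    (∑ j ∈ T, E j).rank = ∑ j ∈ T, (E j).rank := by
  have := Matrix.trace_eq_rank_of_mul_self_eq (h.mul_self_sum T)
  rw [Matrix.trace_sum] at this
  simp only [fun j => Matrix.trace_eq_rank_of_mul_self_eq (h.idem j)] at this
  exact_mod_cast this.symm

theorem trace_hadamard_mul (h : S.IsPrimitiveIdempotents E) {q : J → J → J → ℂ}
    (hq : IsKreinParameters E q) {i j k : J} (hijk : q i j k = 0) :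
    ((E i ⊙ E j) * E k).trace = 0 := by
  have e : (E i ⊙ E j) * E k = 0 := by
    have h1 : (Fintype.card X : ℂ) • ((E i ⊙ E j) * E k) = 0 := by
      rw [← Matrix.smul_mul, hq i j]
      classical
      have h2 : E k = ∑ l, (Pi.single k (1 : ℂ) : J → ℂ) l • E l := by
        simp [Pi.single_apply, ite_smul]
      rw [h2, h.sum_smul_mul_sum_smul]
      refine Finset.sum_eq_zero fun l _ => ?_
      by_cases hl : l = k
      · rw [hl, hijk, zero_mul, zero_smul]
      · rw [Pi.single_eq_of_ne hl, mul_zero, zero_smul]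
    exact (smul_eq_zero.1 h1).resolve_left S.card_ne_zero
  rw [e, Matrix.trace_zero]

/-- The vanishing of a Krein parameter `q_{ij}^k` forces the entrywise products of vectors from the
`i`-th and the `j`-th eigenspace to have no component in the `k`-th eigenspace. -/
theorem mulVec_mul_mulVec_eq_zero (h : S.IsPrimitiveIdempotents E) {q : J → J → J → ℂ}
    (hq : IsKreinParameters E q) {i j k : J} (hijk : q i j k = 0) (f g : X → ℂ) :
    E k *ᵥ ((E i *ᵥ f) * (E j *ᵥ g)) = 0 :=
  Matrix.mulVec_mul_mulVec_eq_zero_of_trace_hadamard_mul_eq_zero (h.isHermitian i)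
    (h.isHermitian j) (h.isHermitian k) (h.idem i) (h.idem j) (h.idem k)
    (h.trace_hadamard_mul hq hijk) f g

end IsPrimitiveIdempotents

end AssocScheme

/-! ### Designs and the dimension bound. -/

namespace AssocScheme

variable {X I J : Type*} [Fintype X] {S : AssocScheme X I} {E : J → Matrix X X ℂ}

theorem IsSecondEigenmatrix.card_mul_apply [Fintype I] {Q : Matrix I J ℂ}
    (hQ : S.IsSecondEigenmatrix E Q) (j : J) (x y : X) :
    (Fintype.card X : ℂ) * E j x y = Q (S.rel x y) j := by
  rw [← S.sum_smul_adj_apply (fun i => Q i j), ← hQ j, Matrix.smul_apply, smul_eq_mul]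

theorem sum_innerDistribution_mul [Fintype I] (S : AssocScheme X I) (Y : Finset X) (c : I → ℂ) :
    ∑ i, (S.innerDistribution Y i : ℂ) * c i =
      (∑ x ∈ Y, ∑ y ∈ Y, c (S.rel x y)) / (Y.card : ℂ) := by
  classical
  have e : ∀ i, (S.innerDistribution Y i : ℂ) * c i =
      (∑ x ∈ Y, ∑ y ∈ Y, if S.rel x y = i then c i else 0) / (Y.card : ℂ) := by
    intro i
    have hcard : Nat.card {p : X × X // p.1 ∈ Y ∧ p.2 ∈ Y ∧ S.rel p.1 p.2 = i} =
        ((Y ×ˢ Y).filter fun p => S.rel p.1 p.2 = i).card := by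
      rw [Nat.card_eq_fintype_card, Fintype.card_subtype]
      congr 1
      ext p
      simp [and_assoc]
    rw [innerDistribution, hcard, ← Finset.sum_product', ← Finset.sum_filter, Finset.sum_const,
      nsmul_eq_mul]
    push_cast
    ring
  simp only [e]
  rw [← Finset.sum_div, Finset.sum_comm]
  congr 1
  refine Finset.sum_congr rfl fun x _ => ?_
  rw [Finset.sum_comm]
  simp

open ComplexOrder in
open Classical in
/-- The characteristic vector of a `T`-design is orthogonal to the eigenspaces indexed by `T`. -/
theorem IsSetDesign.mulVec_indicator_eq_zero [Fintype I] [Fintype J]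
    (hE : S.IsPrimitiveIdempotents E) {Q : Matrix I J ℂ} (hQ : S.IsSecondEigenmatrix E Q)
    {T : Set J} {Y : Finset X} (hY : Y.Nonempty) (h : S.IsSetDesign Q T Y) {j : J} (hj : j ∈ T) :
    E j *ᵥ (fun x => if x ∈ Y then 1 else 0) = 0 := by
  have h1 := h j hj
  have hY0 : (Y.card : ℂ) ≠ 0 := by exact_mod_cast hY.card_pos.ne'
  rw [S.sum_innerDistribution_mul Y (fun i => Q i j), div_eq_zero_iff, or_iff_left hY0] at h1
  simp only [← hQ.card_mul_apply, ← Finset.mul_sum] at h1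
  have h2 := (mul_eq_zero.1 h1).resolve_left S.card_ne_zero
  -- With χ the indicator of Y, ‖E_j χ‖² = χ* E_j χ, which is the sum of the entries of `E j` over Y
  -- × Y.
  rw [← dotProduct_star_self_eq_zero, Matrix.star_mulVec, (hE.isHermitian j).eq,
    ← Matrix.dotProduct_mulVec, Matrix.mulVec_mulVec, hE.idem]
  refine Eq.trans ?_ h2
  simp [dotProduct, Matrix.mulVec, apply_ite]

open ComplexOrder in
open Classical in
/-- The ranks of the idempotents in `T` sum up to at most `|Y|`, if the characteristic vector
of `Y` is orthogonal to all nontrivial eigenspaces that occur in products of those indexed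
by `T`. -/
theorem IsPrimitiveIdempotents.sum_rank_le_card [Fintype J] (hE : S.IsPrimitiveIdempotents E)
    {q : J → J → J → ℂ} (hq : IsKreinParameters E q) {o : J}
    (ho : ∀ x y, E o x y = (Fintype.card X : ℂ)⁻¹) {T : Finset J}
    (hT : ∀ i ∈ T, ∀ j, (E i)ᵀ = E j → j ∈ T) {Y : Finset X} (hY : Y.Nonempty)
    (hTY : ∀ i ∈ T, ∀ j ∈ T, ∀ k, k ≠ o → q i j k ≠ 0 →
      E k *ᵥ (fun x => if x ∈ Y then 1 else 0) = 0) :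
    ∑ i ∈ T, (E i).rank ≤ Y.card := by
  set χ : X → ℂ := fun x => if x ∈ Y then 1 else 0 with hχ
  have hstarχ : star χ = χ := by
    ext x
    simp [hχ, apply_ite]
  set F := ∑ i ∈ T, E i with hF
  -- a vector of the sum of the eigenspaces that vanishes on `Y` is zero
  have key : ∀ f : X → ℂ, F *ᵥ f = f → (∀ y ∈ Y, f y = 0) → f = 0 := by
    intro f hf hfY
    have hf' : f = ∑ i ∈ T, E i *ᵥ f := by
      conv_lhs => rw [← hf, hF, Matrix.sum_mulVec]
    choose τ hτ using hE.exists_transpose_eq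
    -- Since `E i` is Hermitian, its entrywise conjugate is its transpose `E (τ i)`.
    have hstar : star f = ∑ i ∈ T, E (τ i) *ᵥ star f := by
      conv_lhs => rw [hf', star_sum]
      refine Finset.sum_congr rfl fun i _ => ?_
      rw [Matrix.star_mulVec, (hE.isHermitian i).eq, ← hτ, Matrix.mulVec_transpose]
    have hprod : ∀ k, k ≠ o → χ ⬝ᵥ (E k *ᵥ (f * star f)) = 0 := by
      intro k hk
      by_cases hkχ : E k *ᵥ χ = 0
      · rw [Matrix.dotProduct_mulVec, ← hstarχ, ← (hE.isHermitian k).eq, ← Matrix.star_mulVec,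
          hkχ, star_zero, zero_dotProduct]
      · have : E k *ᵥ (f * star f) = 0 := by
          rw [hstar]
          nth_rw 1 [hf']
          rw [Finset.sum_mul_sum, Matrix.mulVec_sum]
          refine Finset.sum_eq_zero fun i hi => ?_
          rw [Matrix.mulVec_sum]
          refine Finset.sum_eq_zero fun j hj => ?_
          refine hE.mulVec_mul_mulVec_eq_zero hq ?_ _ _
          by_contra hne
          exact hkχ (hTY i hi (τ j) (hT j hj _ (hτ j)) k hk hne)
        rw [this, dotProduct_zero]
    have hsum : χ ⬝ᵥ (f * star f) = χ ⬝ᵥ (E o *ᵥ (f * star f)) := by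
      conv_lhs => rw [← Matrix.one_mulVec (f * star f), ← hE.sum_eq_one, Matrix.sum_mulVec,
        dotProduct_sum]
      exact Finset.sum_eq_single o (fun k _ hk => hprod k hk) (by simp)
    have hleft : χ ⬝ᵥ (f * star f) = 0 := by
      refine Finset.sum_eq_zero fun x _ => ?_
      by_cases hx : x ∈ Y
      · simp [hfY x hx]
      · simp [hχ, hx]
    -- `E o` replaces a function by its mean.
    have hright : χ ⬝ᵥ (E o *ᵥ (f * star f)) =
        (Y.card : ℂ) * ((Fintype.card X : ℂ)⁻¹ * (star f ⬝ᵥ f)) := by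
      simp only [Matrix.mulVec, dotProduct, ho, ← Finset.mul_sum, ← Finset.sum_mul, hχ]
      simp [mul_comm]
    rw [hleft, hright, eq_comm, mul_eq_zero, mul_eq_zero, or_iff_right, or_iff_right,
      dotProduct_star_self_eq_zero] at hsum
    · exact hsum
    · exact inv_ne_zero S.card_ne_zero
    · exact_mod_cast hY.card_pos.ne'
  rw [← hE.rank_sum, Matrix.rank, ← Fintype.card_coe Y, ← Module.finrank_fintype_fun_eq_card ℂ]
  let res : (X → ℂ) →ₗ[ℂ] (Y → ℂ) := LinearMap.funLeft ℂ ℂ Subtype.val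
  refine LinearMap.finrank_le_finrank_of_injective
    (f := res.comp (LinearMap.range F.mulVecLin).subtype) ?_
  rw [← LinearMap.ker_eq_bot, LinearMap.ker_eq_bot']
  rintro ⟨f, g, rfl⟩ hf
  refine Subtype.ext (key _ ?_ fun y hy => congrFun hf ⟨y, hy⟩)
  change F *ᵥ (F *ᵥ g) = F *ᵥ g
  rw [Matrix.mulVec_mulVec, hF, hE.mul_self_sum]

end AssocScheme

/-! ### Hadamard monomials and the support of the Krein parameters. -/

section HadamardMonomial

variable {X : Type*} {ℓ : ℕ} (F : Fin ℓ → Matrix X X ℂ)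

theorem hadamardMonomial_add (β γ : Fin ℓ →₀ ℕ) :
    hadamardMonomial F (β + γ) = hadamardMonomial F β ⊙ hadamardMonomial F γ := by
  ext x y
  simp [hadamardMonomial, pow_add, Finset.prod_mul_distrib]

theorem hadamardMonomial_single (i : Fin ℓ) : hadamardMonomial F (Finsupp.single i 1) = F i := by
  ext x y
  simp [hadamardMonomial, Finsupp.single_apply, pow_ite]

end HadamardMonomial

namespace AssocScheme

variable {X I : Type*} [Fintype X] {ℓ : ℕ} {S : AssocScheme X I} {m : MonomialOrder (Fin ℓ)}
  {D : Finset (Fin ℓ →₀ ℕ)} {E : D → Matrix X X ℂ}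

namespace IsQPolynomial

theorem zero_mem (hE : S.IsQPolynomial m D E) : 0 ∈ D := by
  classical
  have := S.nonempty
  by_cases hD : D.Nonempty
  · obtain ⟨n, hn⟩ := hD
    exact hE.lower n hn 0 (by simp)
  -- Only ℓ = 0 leaves room for an empty `D`; the identity of a nonempty X would then be an empty
  -- sum.
  · rw [Finset.not_nonempty_iff_eq_empty] at hD
    subst hD
    have := hE.idempotents.sum_eq_one
    simp at this

/-- The idempotent with label `0` is `|X|⁻¹ J`. -/
theorem apply_zero (hE : S.IsQPolynomial m D E) (x y : X) :
    E ⟨0, hE.zero_mem⟩ x y = (Fintype.card X : ℂ)⁻¹ := by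
  have hX := S.card_ne_zero
  obtain ⟨v, -, hv, hev⟩ := hE.polynomial ⟨0, hE.zero_mem⟩
  -- 0 is least in the monomial order, so v is constant; idempotence then fixes its value at 1.
  have hvC : v = MvPolynomial.C (v.coeff 0) := by
    ext β
    rw [MvPolynomial.coeff_C]
    split_ifs with h
    · rw [h]
    · by_contra hβ
      have h0 := (hv β (MvPolynomial.mem_support_iff.2 hβ)).1
      rw [map_zero, ← m.eq_zero_iff, m.toSyn_eq_zero_iff] at h0
      exact h h0.symm
  rw [hvC] at hev
  simp only [MvPolynomial.eval_C] at hev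
  set c := v.coeff 0
  have hent : ∀ x y, E ⟨0, hE.zero_mem⟩ x y = c * (Fintype.card X : ℂ)⁻¹ := fun x y => by
    rw [← hev x y]
    field_simp
  have hc0 : c ≠ 0 := by
    intro hc
    refine hE.idempotents.ne_zero ⟨0, hE.zero_mem⟩ ?_
    ext x y
    rw [hent, hc, zero_mul, Matrix.zero_apply]
  have hidem := congrFun (congrFun (hE.idempotents.idem ⟨0, hE.zero_mem⟩) x) y
  simp only [Matrix.mul_apply, hent, Finset.sum_const, Finset.card_univ, nsmul_eq_mul] at hidem
  have hc1 : c = 1 := by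
    field_simp at hidem
    exact hidem
  rw [hent, hc1, one_mul]

/-- The idempotents with labels `ε_1, …, ε_ℓ`. -/
noncomputable abbrev gens (hE : S.IsQPolynomial m D E) (j : Fin ℓ) : Matrix X X ℂ :=
  E ⟨Finsupp.single j 1, hE.eps_mem j⟩

theorem exists_eq_sum_hadamardMonomial (hE : S.IsQPolynomial m D E) (α : D) :
    ∃ (s : Finset (Fin ℓ →₀ ℕ)) (c : (Fin ℓ →₀ ℕ) → ℂ), (α : Fin ℓ →₀ ℕ) ∈ s ∧ c α ≠ 0 ∧
      (∀ β ∈ s, β ≼[m] (α : Fin ℓ →₀ ℕ) ∧ β ∈ D) ∧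
      E α = ∑ β ∈ s, c β • hadamardMonomial hE.gens β := by
  have hX := S.card_ne_zero
  obtain ⟨v, hv0, hv, hev⟩ := hE.polynomial α
  refine ⟨v.support, fun β => (Fintype.card X : ℂ)⁻¹ *
    (v.coeff β * ∏ i, (Fintype.card X : ℂ) ^ β i), MvPolynomial.mem_support_iff.2 hv0, ?_, hv, ?_⟩
  · exact mul_ne_zero (inv_ne_zero hX)
      (mul_ne_zero hv0 (Finset.prod_ne_zero_iff.2 fun i _ => pow_ne_zero _ hX))
  · ext x y
    have h := hev x y
    rw [MvPolynomial.eval_eq'] at h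
    rw [← inv_mul_cancel_left₀ hX (E α x y), h, Matrix.sum_apply, Finset.mul_sum]
    refine Finset.sum_congr rfl fun β _ => ?_
    simp only [Matrix.smul_apply, smul_eq_mul, hadamardMonomial, Matrix.of_apply, mul_pow,
      Finset.prod_mul_distrib]
    ring

/-- Induction on β for divisibility: split off one generator, reduce the rest into `D`, and apply
the recurrence. Compatibility of ≼ with addition keeps the bound. -/
theorem hadamardMonomial_mem_span_hadamardMonomial (hE : S.IsQPolynomial m D E)
    (β : Fin ℓ →₀ ℕ) :
    hadamardMonomial hE.gens β ∈ Submodule.span ℂ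
      {M | ∃ γ ∈ D, γ ≼[m] β ∧ M = hadamardMonomial hE.gens γ} := by
  induction β using WellFoundedLT.induction with
  | ind β ih =>
  by_cases hβ : β = 0
  · exact Submodule.subset_span ⟨β, hβ ▸ hE.zero_mem, le_rfl, rfl⟩
  obtain ⟨i, hi⟩ := Finsupp.ne_iff.1 hβ
  have hle : Finsupp.single i 1 ≤ β :=
    Finsupp.single_le_iff.2 (Nat.one_le_iff_ne_zero.2 hi)
  obtain ⟨β', rfl⟩ := exists_add_of_le hle
  have hlt : β' < Finsupp.single i 1 + β' :=
    lt_add_of_pos_left _ (pos_iff_ne_zero.2 (by simp))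
  rw [hadamardMonomial_add, hadamardMonomial_single]
  refine Submodule.span_induction (p := fun M _ => hE.gens i ⊙ M ∈ Submodule.span ℂ
    {M | ∃ γ ∈ D, γ ≼[m] Finsupp.single i 1 + β' ∧ M = hadamardMonomial hE.gens γ})
    ?_ ?_ ?_ ?_ (ih β' hlt)
  · rintro _ ⟨γ, hγ, hγβ, rfl⟩
    refine Submodule.span_mono ?_ (hE.recurrence i γ hγ)
    rintro _ ⟨δ, hδ, hδγ, rfl⟩
    refine ⟨δ, hδ, hδγ.trans ?_, rfl⟩
    rw [add_comm (Finsupp.single i 1), map_add, map_add]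
    gcongr
  · simp
  · intro M N _ _ hM hN
    rw [Matrix.hadamard_add]
    exact add_mem hM hN
  · intro c M _ hM
    rw [Matrix.hadamard_smul]
    exact Submodule.smul_mem _ c hM

/-- Inverts a triangular system: `E γ` has leading monomial γ with nonzero coefficient, and its
other monomials are strictly smaller and lie in `D`. -/
theorem hadamardMonomial_mem_span_of_mem (hE : S.IsQPolynomial m D E) (γ : D) :
    hadamardMonomial hE.gens γ ∈ Submodule.span ℂ
      {M | ∃ δ : D, (δ : Fin ℓ →₀ ℕ) ≼[m] (γ : Fin ℓ →₀ ℕ) ∧ M = E δ} := by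
  classical
  obtain ⟨a, ha⟩ : ∃ a, a = m.toSyn γ := ⟨_, rfl⟩
  induction a using WellFoundedLT.induction generalizing γ with
  | ind a ih =>
  subst ha
  obtain ⟨s, c, hγs, hc, hs, hsum⟩ := hE.exists_eq_sum_hadamardMonomial γ
  rw [← Finset.add_sum_erase _ _ hγs, ← sub_eq_iff_eq_add] at hsum
  rw [← inv_smul_smul₀ hc (hadamardMonomial hE.gens γ), ← hsum]
  refine Submodule.smul_mem _ _ (sub_mem (Submodule.subset_span ⟨γ, le_rfl, rfl⟩)
    (Submodule.sum_mem _ fun β hβ => Submodule.smul_mem _ _ ?_))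
  obtain ⟨hne, hβs⟩ := Finset.mem_erase.1 hβ
  obtain ⟨hle, hβD⟩ := hs β hβs
  have hlt : m.toSyn β < m.toSyn γ := lt_of_le_of_ne hle fun h => hne (m.toSyn.injective h)
  refine Submodule.span_mono ?_ (ih _ hlt ⟨β, hβD⟩ rfl)
  rintro _ ⟨δ, hδ, rfl⟩
  exact ⟨δ, hδ.trans hle, rfl⟩

theorem hadamardMonomial_mem_span (hE : S.IsQPolynomial m D E) (β : Fin ℓ →₀ ℕ) :
    hadamardMonomial hE.gens β ∈ Submodule.span ℂ
      {M | ∃ δ : D, (δ : Fin ℓ →₀ ℕ) ≼[m] β ∧ M = E δ} := by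
  refine Submodule.span_le.2 ?_ (hE.hadamardMonomial_mem_span_hadamardMonomial β)
  rintro _ ⟨γ, hγ, hγβ, rfl⟩
  refine Submodule.span_mono ?_ (hE.hadamardMonomial_mem_span_of_mem ⟨γ, hγ⟩)
  rintro _ ⟨δ, hδ, rfl⟩
  exact ⟨δ, hδ.trans hγβ, rfl⟩

theorem hadamard_mem_span (hE : S.IsQPolynomial m D E) (α β : D) :
    E α ⊙ E β ∈ Submodule.span ℂ
      {M | ∃ δ : D, (δ : Fin ℓ →₀ ℕ) ≼[m] ((α : Fin ℓ →₀ ℕ) + β) ∧ M = E δ} := by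
  obtain ⟨s, b, -, -, hs, hb⟩ := hE.exists_eq_sum_hadamardMonomial α
  obtain ⟨t, c, -, -, ht, hc⟩ := hE.exists_eq_sum_hadamardMonomial β
  have e : E α ⊙ E β = ∑ μ ∈ s, ∑ ν ∈ t, (b μ * c ν) • hadamardMonomial hE.gens (μ + ν) := by
    rw [hb, hc]
    ext x y
    simp only [Matrix.hadamard_apply, Matrix.sum_apply, Finset.sum_mul_sum, hadamardMonomial_add,
      Matrix.smul_apply, smul_eq_mul]
    exact Finset.sum_congr rfl fun μ _ => Finset.sum_congr rfl fun ν _ => by ring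
  rw [e]
  refine Submodule.sum_mem _ fun μ hμ => Submodule.sum_mem _ fun ν hν =>
    Submodule.smul_mem _ _ (Submodule.span_mono ?_ (hE.hadamardMonomial_mem_span (μ + ν)))
  rintro _ ⟨δ, hδ, rfl⟩
  refine ⟨δ, hδ.trans ?_, rfl⟩
  rw [map_add, map_add]
  exact add_le_add (hs μ hμ).1 (ht ν hν).1

/-- The Krein parameter `q_{αβ}^γ` vanishes unless `γ ≼ α + β`. -/
theorem le_add_of_krein_ne_zero (hE : S.IsQPolynomial m D E) {q : D → D → D → ℂ}
    (hq : IsKreinParameters E q) {α β γ : D} (h : q α β γ ≠ 0) :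
    (γ : Fin ℓ →₀ ℕ) ≼[m] ((α : Fin ℓ →₀ ℕ) + β) := by
  by_contra hγ
  have hzero : E γ * (E α ⊙ E β) = 0 := by
    refine Submodule.span_induction (p := fun M _ => E γ * M = 0) ?_ ?_ ?_ ?_
      (hE.hadamard_mem_span α β)
    · rintro _ ⟨δ, hδ, rfl⟩
      exact hE.idempotents.orthogonal γ δ (by rintro rfl; exact hγ hδ)
    · simp
    · intro M N _ _ hM hN
      rw [mul_add, hM, hN, add_zero]
    · intro c M _ hM
      rw [Matrix.mul_smul, hM, smul_zero]
  have := hE.idempotents.mul_sum_smul γ (q α β)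
  rw [← hq α β, Matrix.mul_smul, hzero, smul_zero, eq_comm, smul_eq_zero] at this
  exact this.elim h (hE.idempotents.ne_zero γ)

/-! ### Distance functions and the Rao bound. -/

theorem isDualDistance_weightedDegree (hE : S.IsQPolynomial m D E) {q : D → D → D → ℂ}
    (hq : IsKreinParameters E q) {w : Fin ℓ → ℝ} (hw : ∀ i, 0 < w i)
    (hmono : ∀ α β : Fin ℓ →₀ ℕ, α ≼[m] β → weightedDegree w α ≤ weightedDegree w β)
    (hsymm : ∀ i j : D, (E i)ᵀ = E j → weightedDegree w i = weightedDegree w j) :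
    IsDualDistance E q fun i => weightedDegree w i := by
  have hterm : ∀ (α : Fin ℓ →₀ ℕ) i, 0 ≤ w i * α i := fun α i =>
    mul_nonneg (hw i).le (Nat.cast_nonneg _)
  refine ⟨fun α => Finset.sum_nonneg fun i _ => hterm α i, fun α => ?_, hsymm, ?_⟩
  · rw [weightedDegree, Finset.sum_eq_zero_iff_of_nonneg fun i _ => hterm α i, Finsupp.ext_iff]
    simp [(hw _).ne']
  · intro α β γ h
    -- α + β may lie outside `D`, which is why monotonicity is needed on all of ℕ^ℓ.
    refine (hmono _ _ (hE.le_add_of_krein_ne_zero hq h)).trans_eq ?_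
    simp [weightedDegree, mul_add, Finset.sum_add_distrib]

/-- In a formally self-dual scheme the Krein parameters are the intersection numbers. -/
theorem adj_mul_adj_eq_sum_krein [Fintype I] (hE : S.IsQPolynomial m D E) {Q : Matrix I D ℂ}
    (hQ : S.IsSecondEigenmatrix E Q) {q : D → D → D → ℂ} (hq : IsKreinParameters E q)
    {φ : D ≃ I} {P : Matrix D I ℂ} (hP : S.IsFirstEigenmatrix E P)
    (hPQ : ∀ α β : D, P β (φ α) = Q (φ β) α) (α β : D) :
    S.adj (φ α) * S.adj (φ β) = ∑ γ, q α β γ • S.adj (φ γ) := by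
  -- The Krein identity read at one entry. By self-duality it becomes the multiplication of first
  -- eigenvalues, which is the matrix product in the basis E.
  have hQmul : ∀ i, Q i α * Q i β = ∑ γ, q α β γ * Q i γ := by
    intro i
    obtain ⟨x, y, rfl⟩ := S.rel_surjective i
    have h := congrFun (congrFun (hq α β) x) y
    simp only [Matrix.smul_apply, Matrix.hadamard_apply, Matrix.sum_apply, smul_eq_mul] at h
    simp only [← hQ.card_mul_apply]
    calc _ = (Fintype.card X : ℂ) * ((Fintype.card X : ℂ) * (E α x y * E β x y)) := by ring
      _ = _ := by
        rw [h, Finset.mul_sum]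
        exact Finset.sum_congr rfl fun γ _ => by ring
  rw [hP (φ α), hP (φ β), hE.idempotents.sum_smul_mul_sum_smul]
  simp only [hPQ, hQmul, hP (φ _), Finset.smul_sum, Finset.sum_smul, smul_smul]
  exact Finset.sum_comm

theorem isDualDistance_of_isWeaklyMetric [Fintype I] (hE : S.IsQPolynomial m D E)
    {Q : Matrix I D ℂ} (hQ : S.IsSecondEigenmatrix E Q) {q : D → D → D → ℂ}
    (hq : IsKreinParameters E q) {φ : D ≃ I} {P : Matrix D I ℂ} (hP : S.IsFirstEigenmatrix E P)
    (hPQ : ∀ α β : D, P β (φ α) = Q (φ β) α) {δ : X → X → ℝ} {c : I → ℝ}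
    (hδ : S.IsWeaklyMetric δ c) : IsDualDistance E q fun α => c (φ α) := by
  classical
  -- The column `Q · 0` is constantly 1, so self-duality gives A_{φ 0} = ∑ E_β = 1.
  have hφ0 : φ ⟨0, hE.zero_mem⟩ = S.diag := by
    obtain ⟨x⟩ := S.nonempty
    have h1 : S.adj (φ ⟨0, hE.zero_mem⟩) = 1 := by
      rw [hP, ← hE.idempotents.sum_eq_one]
      refine Finset.sum_congr rfl fun β _ => ?_
      obtain ⟨x, y, hxy⟩ := S.rel_surjective (φ β)
      rw [hPQ, ← hxy, ← hQ.card_mul_apply, hE.apply_zero, mul_inv_cancel₀ S.card_ne_zero, one_smul]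
    have h2 := congrFun (congrFun h1 x) x
    rw [← (S.rel_eq_diag_iff x x).2 rfl]
    by_contra hne
    simp [adj, Ne.symm hne] at h2
  refine ⟨fun α => ?_, fun α => ?_, fun α β h => ?_, fun α β γ h => ?_⟩
  · obtain ⟨x, y, hxy⟩ := S.rel_surjective (φ α)
    rw [← hxy, ← hδ.eq_on_class]
    exact hδ.nonneg x y
  · obtain ⟨x, y, hxy⟩ := S.rel_surjective (φ α)
    rw [← hxy, ← hδ.eq_on_class, hδ.eq_zero_iff, ← S.rel_eq_diag_iff, hxy, ← hφ0,
      φ.apply_eq_iff_eq, Subtype.ext_iff]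
  -- Transposing `E α` conjugates column α of Q, hence by self-duality the eigenvalues of `S.adj (φ
  -- α)`: this is its adjoint.
  · have hadj : S.adj (φ β) = (S.adj (φ α))ᵀ := by
      rw [← S.conjTranspose_adj, hP (φ β), hP (φ α), Matrix.conjTranspose_sum]
      refine Finset.sum_congr rfl fun ζ _ => ?_
      rw [Matrix.conjTranspose_smul, (hE.idempotents.isHermitian ζ).eq, hPQ, hPQ]
      obtain ⟨x, y, hxy⟩ := S.rel_surjective (φ ζ)
      rw [← hxy, ← hQ.card_mul_apply, ← hQ.card_mul_apply, ← h, star_mul',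
        hE.idempotents.star_apply, Matrix.transpose_apply, star_natCast]
    obtain ⟨x, y, hxy⟩ := S.rel_surjective (φ α)
    have hyx : S.rel y x = φ β := by
      have h1 := congrFun (congrFun hadj y) x
      rw [Matrix.transpose_apply, ← hxy, adj_apply_rel] at h1
      by_contra hne
      simp [adj, hne] at h1
    change c (φ α) = c (φ β)
    rw [← hxy, ← hyx, ← hδ.eq_on_class, ← hδ.eq_on_class, hδ.symm]
  · obtain ⟨x, y, hxy⟩ := S.rel_surjective (φ γ)
    have h1 := congrFun (congrFun (hE.adj_mul_adj_eq_sum_krein hQ hq hP hPQ α β) x) y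
    have h2 : (∑ γ, q α β γ • S.adj (φ γ)) x y = q α β γ := by
      simp [Matrix.sum_apply, adj, hxy]
    rw [h2, Matrix.mul_apply] at h1
    -- A nonzero `q α β γ` counts at least one z with (x, z) in class `φ α` and (z, y) in class `φ
    -- β`.
    obtain ⟨z, -, hz⟩ := Finset.exists_ne_zero_of_sum_ne_zero (h1.trans_ne h)
    have hxz : S.rel x z = φ α := by
      by_contra hne
      simp [adj, hne] at hz
    have hzy : S.rel z y = φ β := by
      by_contra hne
      simp [adj, hne] at hz
    change c (φ γ) ≤ c (φ α) + c (φ β)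
    rw [← hxy, ← hxz, ← hzy, ← hδ.eq_on_class, ← hδ.eq_on_class, ← hδ.eq_on_class]
    exact hδ.triangle x y z

open Classical in
/-- The distance Rao bound. -/
theorem sum_rank_le_card_of_isDesign [Fintype I] (hE : S.IsQPolynomial m D E) {Q : Matrix I D ℂ}
    (hQ : S.IsSecondEigenmatrix E Q) {q : D → D → D → ℂ} (hq : IsKreinParameters E q)
    {d : D → ℝ} (hd : IsDualDistance E q d) {t : ℕ} {Y : Finset X} (hY : Y.Nonempty)
    (hdes : S.IsDesign Q d t Y) :
    ∑ i : D with d i ≤ ((t / 2 : ℕ) : ℝ), (E i).rank ≤ Y.card := by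
  refine hE.idempotents.sum_rank_le_card hq hE.apply_zero ?_ hY ?_
  · intro i hi j hij
    rw [Finset.mem_filter] at hi ⊢
    exact ⟨Finset.mem_univ _, hd.symm i j hij ▸ hi.2⟩
  · intro i hi j hj k hk hne
    rw [Finset.mem_filter] at hi hj
    refine IsSetDesign.mulVec_indicator_eq_zero hE.idempotents hQ hY hdes ⟨?_, ?_⟩
    · exact lt_of_le_of_ne (hd.nonneg k) fun h =>
        hk (Subtype.ext ((hd.eq_zero_iff k).1 h.symm))
    · have h2 : (((t / 2 : ℕ) : ℝ)) + ((t / 2 : ℕ) : ℝ) ≤ t := by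
        exact_mod_cast (by omega : t / 2 + t / 2 ≤ t)
      linarith [hd.triangle i j k hne, hi.2, hj.2]

end IsQPolynomial

end AssocScheme

open Classical in
theorem mainTheorem5 {X I : Type*} [Fintype X] [Fintype I] {ℓ : ℕ}
    (S : AssocScheme X I) (m : MonomialOrder (Fin ℓ)) (D : Finset (Fin ℓ →₀ ℕ))
    (E : D → Matrix X X ℂ) (hE : S.IsQPolynomial m D E)
    (Q : Matrix I D ℂ) (hQ : S.IsSecondEigenmatrix E Q)
    (q : D → D → D → ℂ) (hq : IsKreinParameters E q) :
    -- the distance Rao bound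
    (∀ d : D → ℝ, IsDualDistance E q d →
      ∀ t : ℕ, 0 < t → ∀ Y : Finset X, Y.Nonempty → S.IsDesign Q d t Y →
        ∑ i : D with d i ≤ ((t / 2 : ℕ) : ℝ), (E i).rank ≤ Y.card) ∧
    -- it applies to weighted degrees compatible with the monomial order
    (∀ w : Fin ℓ → ℝ, (∀ i, 0 < w i) →
      (∀ α β : Fin ℓ →₀ ℕ, α ≼[m] β → weightedDegree w α ≤ weightedDegree w β) →
      (∀ i j : D, (E i)ᵀ = E j → weightedDegree w i = weightedDegree w j) →
      IsDualDistance E q fun i => weightedDegree w i) ∧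
    -- it applies to a distance on `X` constant on the classes of a formally self-dual scheme
    (∀ (φ : D ≃ I) (P : Matrix D I ℂ), S.IsFirstEigenmatrix E P →
      (∀ α β : D, P β (φ α) = Q (φ β) α) →
      ∀ (δ : X → X → ℝ) (c : I → ℝ), S.IsWeaklyMetric δ c →
        IsDualDistance E q fun α => c (φ α)) := by
  exact ⟨fun _ hd _ _ _ hY hdes => hE.sum_rank_le_card_of_isDesign hQ hq hd hY hdes,
    fun _ hw hmono hsymm => hE.isDualDistance_weightedDegree hq hw hmono hsymm,
    fun _ _ hP hPQ _ _ hδ => hE.isDualDistance_of_isWeaklyMetric hQ hq hP hPQ hδ⟩
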